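/- Let $A=(a_{ij})\in\mathbb{R}^{n\times n}$, $n\ge 3$, be a symmetric matrix whose diagonal is not identically zero. For a square matrix $M$ let $D(M)$ denote the diagonal matrix with the same diagonal elements as $M$, let $\|M\|_2$ be the spectral norm, and let $\|M\|_\infty=\max_i\sum_j|m_{ij}|$. Let $w_1,\dots,w_N$ be independent standard Gaussian random vectors $w_k\sim\mathcal{N}(0,I)$ in $\mathbb{R}^n$, and let $$\widehat A=\frac1N\sum_{k=1}^N A\,w_k w_k^{\top}.$$ Let $\epsilon>0$ and $0<\delta<1$. If the number of samples $N$ satisfies $8e\ln n\le N\le n$ and $$N\ \ge\ \frac{128\,(e\ln n)^3}{\epsilon^2\,\delta}\left(\frac{\|A\|_\infty}{\|D(A)\|_\infty}\right)^2,$$ then $$\|D(\widehat A)-D(A)\|_2\ \le\ \epsilon\,\|D(A)\|_2$$ holds with probability at least $1-\delta$. -/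

import Mathlib

/-- The spectral norm `‖A‖₂`: the operator norm of `A` acting on Euclidean space. -/
noncomputable def matrixTwoNorm {n : ℕ} (A : Matrix (Fin n) (Fin n) ℝ) : ℝ :=
  ‖Matrix.toEuclideanCLM (n := Fin n) (𝕜 := ℝ) A‖

/-- The matrix infinity norm `‖A‖_∞`, i.e. the maximal absolute row sum
(the operator norm for the sup norm on vectors). -/
noncomputable def matrixInfNorm {n : ℕ} (A : Matrix (Fin n) (Fin n) ℝ) : ℝ :=
  letI := Matrix.linftyOpNormedAddCommGroup (m := Fin n) (n := Fin n) (α := ℝ)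
  ‖A‖

/-- `D(A) = diag(diag(A))`: the matrix `A` with its off-diagonal entries replaced by zero. -/
def diagPart {n : ℕ} (A : Matrix (Fin n) (Fin n) ℝ) : Matrix (Fin n) (Fin n) ℝ :=
  Matrix.diagonal A.diag

/-- The Monte Carlo estimator `(1/N) ∑ₖ (A wₖ) wₖᵀ` built from sample vectors `w₁, …, w_N`. -/
noncomputable def monteCarloEstimator {n N : ℕ} (A : Matrix (Fin n) (Fin n) ℝ)
    (w : Fin N → EuclideanSpace ℝ (Fin n)) : Matrix (Fin n) (Fin n) ℝ :=
  (1 / (N : ℝ)) • ∑ k : Fin N, Matrix.vecMulVec (A.mulVec (w k).ofLp) (w k).ofLp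

open MeasureTheory ProbabilityTheory
open scoped RealInnerProductSpace

/-! The `i`-th diagonal error is the mean of `N` independent copies of `∑ j, A i j * (w j * w i - δ
i j)`, with `δ i j` the Kronecker symbol. Each bracket is subexponential of scale 1: a centred
Gaussian square, or by polarisation half the difference of two. Convexity of `exp` handles weighted
sums of dependent terms (`sum_mul`), so the error has scale the absolute row sum, at most `‖A‖_∞`.
Bernstein's inequality for `A` and `-A` and a union bound over `i` give failure probability at most
`2 n exp (-N min(η, η²) / 8)`, where `η = ε ‖D(A)‖_∞ / ‖A‖_∞`; `two_mul_mul_exp_neg_le` bounds this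
by `δ`. -/

/-- A centred subexponential condition with explicit constants: the moment generating function of
`X` is at most `exp (2 t² R²)` as long as `|t| R ≤ 1 / 4`. -/
def IsSubexponential {Ω : Type*} [MeasurableSpace Ω] (X : Ω → ℝ) (μ : Measure Ω) (R : ℝ) : Prop :=
  ∀ t : ℝ, |t| * R ≤ 1 / 4 →
    Integrable (fun ω => Real.exp (t * X ω)) μ ∧ mgf X μ t ≤ Real.exp (2 * (t * R) ^ 2)

/-! ### The centred square of a Gaussian variable. -/

/-- With `y = 2t`, its square root is the bound `exp (-t) / √(1 - 2t) ≤ exp (2t²)` on the moment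
generating function of `x² - 1`. -/
theorem one_le_one_sub_mul_exp_add_sq {y : ℝ} (h₂ : y ≤ 1 / 2) :
    1 ≤ (1 - y) * Real.exp (y + y ^ 2) := by
  rcases le_total y 0 with h | h
  · have := Real.add_one_le_exp (y + y ^ 2)
    nlinarith [mul_le_mul_of_nonneg_left this (by linarith : 0 ≤ 1 - y),
      mul_nonneg (sq_nonneg y) (neg_nonneg.2 h)]
  · have := Real.quadratic_le_exp_of_nonneg (by positivity : 0 ≤ y + y ^ 2)
    have h3 := mul_le_mul_of_nonneg_left this (by linarith : 0 ≤ 1 - y)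
    have h4 : 0 ≤ (1 + y) ^ 2 * (1 - y) - 2 * y := by
      nlinarith [mul_nonneg h (sub_nonneg.2 h₂), mul_nonneg (sq_nonneg y) (sub_nonneg.2 h₂)]
    nlinarith [mul_nonneg (sq_nonneg y) h4]

theorem integral_exp_mul_sq_gaussianReal {s : ℝ} (hs : s < 1 / 2) :
    ∫ x, Real.exp (s * x ^ 2) ∂(gaussianReal 0 1) = (√(1 - 2 * s))⁻¹ := by
  rw [integral_gaussianReal_eq_integral_smul one_ne_zero]
  have h : ∀ x : ℝ, gaussianPDFReal 0 1 x • Real.exp (s * x ^ 2) =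
      (√(2 * Real.pi))⁻¹ * Real.exp (-(1 / 2 - s) * x ^ 2) := by
    intro x
    rw [gaussianPDFReal_def, smul_eq_mul, mul_assoc, ← Real.exp_add]
    congr 2
    · simp
    · simp only [NNReal.coe_one]; ring
  simp_rw [h]
  rw [integral_const_mul, integral_gaussian, ← Real.sqrt_inv, ← Real.sqrt_inv,
    ← Real.sqrt_mul (by positivity)]
  congr 1
  have : 1 / 2 - s ≠ 0 := by linarith
  have : 1 - 2 * s ≠ 0 := by linarith
  field_simp

theorem isSubexponential_sq_sub_one_gaussianReal :
    IsSubexponential (fun x : ℝ => x ^ 2 - 1) (gaussianReal 0 1) 1 := by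
  intro t ht
  rw [mul_one, abs_le] at ht
  have hpos : 0 < 1 - 2 * t := by linarith
  have hsq : 0 < √(1 - 2 * t) := Real.sqrt_pos.2 hpos
  have hint := integral_exp_mul_sq_gaussianReal (s := t) (by linarith)
  have he : ∀ x : ℝ, Real.exp (t * (x ^ 2 - 1)) = Real.exp (-t) * Real.exp (t * x ^ 2) := by
    intro x
    rw [← Real.exp_add]; congr 1; ring
  constructor
  · simp_rw [he]
    refine (Integrable.of_integral_ne_zero ?_).const_mul _
    rw [hint]
    positivity
  · simp only [mgf, he]
    rw [integral_const_mul, hint, ← div_eq_mul_inv, div_le_iff₀ hsq]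
    have h := one_le_one_sub_mul_exp_add_sq (y := 2 * t) (by linarith)
    have h1 : (1 : ℝ) ≤ √(1 - 2 * t) * Real.exp (t + 2 * t ^ 2) := by
      have h2 := Real.sqrt_le_sqrt h
      rw [Real.sqrt_one, Real.sqrt_mul hpos.le, ← Real.exp_half] at h2
      convert h2 using 3
      ring
    have h3 := mul_le_mul_of_nonneg_left h1 (Real.exp_pos (-t)).le
    rw [mul_one, mul_left_comm, ← Real.exp_add] at h3
    rw [mul_comm]
    convert h3 using 3
    ring

theorem map_inner_stdGaussian {E : Type*} [NormedAddCommGroup E] [InnerProductSpace ℝ E]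
    [FiniteDimensional ℝ E] [MeasurableSpace E] [BorelSpace E] {u : E} (hu : ‖u‖ = 1) :
    (stdGaussian E).map (fun x => ⟪u, x⟫) = gaussianReal 0 1 := by
  have h := IsGaussian.map_eq_gaussianReal (μ := stdGaussian E) (innerSL ℝ u)
  rw [integral_strongDual_stdGaussian, variance_dual_stdGaussian, innerSL_apply_norm, hu] at h
  simpa using h

/-! ### Calculus of subexponential variables. -/

namespace IsSubexponential

variable {Ω Ω' : Type*} [MeasurableSpace Ω] [MeasurableSpace Ω'] {μ : Measure Ω}

theorem comp {ν : Measure Ω'} {Y : Ω → Ω'} {X : Ω' → ℝ} {R : ℝ}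
    (hX : IsSubexponential X ν R) (hY : HasLaw Y ν μ) (hXm : Measurable X) :
    IsSubexponential (fun ω => X (Y ω)) μ R := by
  intro t ht
  obtain ⟨hi, hm⟩ := hX t ht
  rw [← hY.map_eq] at hi hm
  have hmeas : Measurable fun x => Real.exp (t * X x) := by fun_prop
  refine ⟨hi.comp_aemeasurable hY.aemeasurable, ?_⟩
  rwa [mgf, integral_map hY.aemeasurable hmeas.aestronglyMeasurable] at hm

theorem mono {X : Ω → ℝ} {R R' : ℝ} (hX : IsSubexponential X μ R) (h₀ : 0 ≤ R) (h : R ≤ R') :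
    IsSubexponential X μ R' := by
  intro t ht
  obtain ⟨hi, hm⟩ := hX t ((mul_le_mul_of_nonneg_left h (abs_nonneg t)).trans ht)
  refine ⟨hi, hm.trans (Real.exp_le_exp.2 ?_)⟩
  rw [mul_pow, mul_pow]
  gcongr

/-- No independence is needed: with weights `|c j| / R`, Jensen's inequality for `exp` bounds the
exponential of the sum by an average of exponentials of single terms. -/
theorem sum_mul [IsProbabilityMeasure μ] {ι : Type*} [Fintype ι] {Z : ι → Ω → ℝ}
    (hZ : ∀ j, IsSubexponential (Z j) μ 1) (hZm : ∀ j, AEMeasurable (Z j) μ) (c : ι → ℝ) :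
    IsSubexponential (fun ω => ∑ j, c j * Z j ω) μ (∑ j, |c j|) := by
  set R := ∑ j, |c j| with hR
  have hR₀ : 0 ≤ R := Finset.sum_nonneg fun j _ => abs_nonneg (c j)
  rcases hR₀.eq_or_lt with hR0 | hRpos
  · have hc : ∀ j, c j = 0 := fun j => abs_eq_zero.1
      ((Finset.sum_eq_zero_iff_of_nonneg fun j _ => abs_nonneg (c j)).1 hR0.symm j
        (Finset.mem_univ j))
    intro t _
    simp [hc, mgf, ← hR0]
  intro t ht
  -- This is `±t R` with the sign of `c j`; where `c j = 0` it is 0, and so is the weight.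
  let s : ι → ℝ := fun j => t * R * (c j / |c j|)
  have hs : ∀ j, |s j| ≤ |t| * R := by
    intro j
    rw [abs_mul, abs_mul, abs_of_pos hRpos, abs_div, abs_abs]
    exact mul_le_of_le_one_right (by positivity) (div_self_le_one _)
  have hb := fun j => hZ j (s j) (by rw [mul_one]; exact (hs j).trans ht)
  have hle : ∀ ω, Real.exp (t * ∑ j, c j * Z j ω) ≤
      ∑ j, |c j| / R * Real.exp (s j * Z j ω) := by
    intro ω
    have h := convexOn_exp.map_sum_le (t := Finset.univ) (w := fun j => |c j| / R)
      (p := fun j => s j * Z j ω) (fun j _ => by positivity)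
      (by rw [← Finset.sum_div, ← hR, div_self hRpos.ne']) (fun j _ => Set.mem_univ _)
    simp only [smul_eq_mul] at h
    refine le_of_eq_of_le ?_ h
    congr 1
    rw [Finset.mul_sum]
    refine Finset.sum_congr rfl fun j _ => ?_
    rcases eq_or_ne (c j) 0 with hj | hj
    · simp [hj]
    · have : |c j| ≠ 0 := abs_ne_zero.2 hj
      simp only [s]
      field_simp
  have hdom : Integrable (fun ω => ∑ j, |c j| / R * Real.exp (s j * Z j ω)) μ :=
    integrable_finsetSum _ fun j _ => (hb j).1.const_mul _
  have hint : Integrable (fun ω => Real.exp (t * ∑ j, c j * Z j ω)) μ := by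
    refine hdom.mono' (AEMeasurable.aestronglyMeasurable (by fun_prop)) (.of_forall fun ω => ?_)
    rw [Real.norm_of_nonneg (Real.exp_pos _).le]
    exact hle ω
  refine ⟨hint, ?_⟩
  calc mgf (fun ω => ∑ j, c j * Z j ω) μ t
      ≤ ∫ ω, ∑ j, |c j| / R * Real.exp (s j * Z j ω) ∂μ := integral_mono hint hdom hle
    _ = ∑ j, |c j| / R * mgf (Z j) μ (s j) := by
      rw [integral_finsetSum _ fun j _ => (hb j).1.const_mul _]
      simp_rw [integral_const_mul]
      rfl
    _ ≤ ∑ j, |c j| / R * Real.exp (2 * (t * R) ^ 2) := by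
      gcongr with j
      refine (hb j).2.trans (Real.exp_le_exp.2 ?_)
      have : (s j) ^ 2 ≤ (t * R) ^ 2 := by
        rw [sq_le_sq, abs_mul t, abs_of_pos hRpos]
        exact hs j
      rw [mul_one]
      linarith
    _ = Real.exp (2 * (t * R) ^ 2) := by
      rw [← Finset.sum_mul, ← Finset.sum_div, ← hR, div_self hRpos.ne', one_mul]

/-- Bernstein's inequality for sums of independent subexponential variables. -/
theorem measureReal_sum_ge_le {N : ℕ} {X : Fin N → Ω → ℝ} {R η : ℝ}
    (hindep : iIndepFun X μ) (hXm : ∀ k, AEMeasurable (X k) μ)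
    (hX : ∀ k, IsSubexponential (X k) μ R) (hR : 0 < R) (hη : 0 ≤ η) :
    μ.real {ω | N * (η * R) ≤ ∑ k, X k ω} ≤ Real.exp (-(N * (min η (η ^ 2) / 8))) := by
  have := hindep.isProbabilityMeasure
  -- The Chernoff exponent `θ η - 2 θ²` peaks at `θ = η / 4`, truncated to the admissible `1 / 4`.
  obtain ⟨θ, hθ₀, hθ₁, hθ⟩ : ∃ θ : ℝ, 0 ≤ θ ∧ θ ≤ 1 / 4 ∧
      min η (η ^ 2) / 8 ≤ θ * η - 2 * θ ^ 2 := by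
    rcases le_total η 1 with h | h
    · refine ⟨η / 4, by positivity, by linarith, ?_⟩
      have := min_le_right η (η ^ 2)
      linarith
    · refine ⟨1 / 4, by norm_num, le_rfl, ?_⟩
      have := min_le_left η (η ^ 2)
      linarith
  have ht : |θ / R| * R ≤ 1 / 4 := by
    rw [abs_of_nonneg (by positivity), div_mul_cancel₀ _ hR.ne']
    exact hθ₁
  have hb := fun k => hX k (θ / R) ht
  have hsum : (fun ω => ∑ k, X k ω) = ∑ k, X k := by
    ext ω
    simp
  have hint : Integrable (fun ω => Real.exp (θ / R * (∑ k, X k) ω)) μ := by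
    -- A non-integrable function has integral 0 by convention, so a positive integral suffices.
    refine Integrable.of_integral_ne_zero (ne_of_gt ?_)
    change 0 < mgf (∑ k, X k) μ (θ / R)
    rw [hindep.mgf_sum₀ hXm]
    exact Finset.prod_pos fun k _ => mgf_pos (hb k).1
  have hch := measure_ge_le_exp_mul_mgf (μ := μ) (X := ∑ k, X k) (N * (η * R))
    (by positivity : 0 ≤ θ / R) hint
  rw [hindep.mgf_sum₀ hXm] at hch
  simp only [Finset.sum_apply] at hch
  refine hch.trans ?_
  calc Real.exp (-(θ / R) * (N * (η * R))) * ∏ k, mgf (X k) μ (θ / R)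
      ≤ Real.exp (-(θ / R) * (N * (η * R))) * ∏ _k : Fin N, Real.exp (2 * (θ / R * R) ^ 2) := by
        gcongr with k
        · exact fun k _ => mgf_nonneg
        · exact (hb k).2
    _ = Real.exp (-(N * (θ * η - 2 * θ ^ 2))) := by
        rw [← Real.exp_sum, ← Real.exp_add, div_mul_cancel₀ _ hR.ne']
        congr 1
        simp
        field_simp
        ring
    _ ≤ _ := by gcongr

end IsSubexponential

/-! ### Products of Gaussian coordinates. -/

/-- Polarisation along the unit vectors `(e ± f) / √2`: the product is half the difference of two
centred squares, and the coefficients `±1/2` have absolute sum 1. -/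
theorem isSubexponential_inner_mul_inner_stdGaussian {E : Type*} [NormedAddCommGroup E]
    [InnerProductSpace ℝ E] [FiniteDimensional ℝ E] [MeasurableSpace E] [BorelSpace E] {e f : E}
    (he : ‖e‖ = 1) (hf : ‖f‖ = 1) (hef : ⟪e, f⟫ = 0) :
    IsSubexponential (fun x => ⟪e, x⟫ * ⟪f, x⟫) (stdGaussian E) 1 := by
  have hsq : (√2 : ℝ) ^ 2 = 2 := Real.sq_sqrt zero_le_two
  have hu : ∀ σ : ℝ, σ ^ 2 = 1 → ‖(√2)⁻¹ • (e + σ • f)‖ = 1 := by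
    intro σ hσ
    have h : ‖(√2)⁻¹ • (e + σ • f)‖ ^ 2 = 1 := by
      rw [norm_smul, mul_pow, norm_add_sq_real, norm_smul, mul_pow, he, hf, inner_smul_right, hef,
        Real.norm_eq_abs, Real.norm_eq_abs, sq_abs, sq_abs, inv_pow, hsq, hσ]
      norm_num
    nlinarith [norm_nonneg ((√2)⁻¹ • (e + σ • f))]
  have hZ : ∀ σ : ℝ, σ ^ 2 = 1 →
      IsSubexponential (fun x => ⟪(√2)⁻¹ • (e + σ • f), x⟫ ^ 2 - 1) (stdGaussian E) 1 :=
    fun σ hσ => isSubexponential_sq_sub_one_gaussianReal.comp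
      ⟨by fun_prop, map_inner_stdGaussian (hu σ hσ)⟩ (by fun_prop)
  have h := IsSubexponential.sum_mul (μ := stdGaussian E)
    (Z := fun (j : Fin 2) x => ⟪(√2)⁻¹ • (e + (![1, -1] j : ℝ) • f), x⟫ ^ 2 - 1)
    (fun j => hZ _ (by fin_cases j <;> simp)) (fun j => by fun_prop) ![1 / 2, -(1 / 2)]
  convert h using 1
  · ext x
    simp only [Fin.sum_univ_two, Matrix.cons_val_zero, Matrix.cons_val_one, inner_smul_left,
      inner_add_left, mul_pow, RCLike.conj_to_real, inv_pow, hsq]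
    ring
  · norm_num [Fin.sum_univ_two, abs_of_pos]

theorem isSubexponential_coord_mul_coord_stdGaussian {ι : Type*} [Fintype ι] [DecidableEq ι]
    (i j : ι) :
    IsSubexponential (fun x : EuclideanSpace ℝ ι => x j * x i - (1 : Matrix ι ι ℝ) i j)
      (stdGaussian (EuclideanSpace ℝ ι)) 1 := by
  have hi : ∀ i : ι, ‖EuclideanSpace.single i (1 : ℝ)‖ = 1 := by simp
  have hin : ∀ (i : ι) (x : EuclideanSpace ℝ ι), ⟪EuclideanSpace.single i (1 : ℝ), x⟫ = x i := by
    intro i x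
    rw [EuclideanSpace.inner_single_left]
    simp
  rcases eq_or_ne i j with rfl | hij
  · have h := isSubexponential_sq_sub_one_gaussianReal.comp
      (Y := fun x => ⟪EuclideanSpace.single i (1 : ℝ), x⟫)
      (μ := stdGaussian (EuclideanSpace ℝ ι))
      ⟨by fun_prop, map_inner_stdGaussian (hi i)⟩ (by fun_prop)
    simpa [hin, sq] using h
  · have h := isSubexponential_inner_mul_inner_stdGaussian (hi j) (hi i)
      (by rw [hin]; simp [hij.symm])
    simpa [hin, hij] using h

theorem isSubexponential_mulVec_mul_coord_stdGaussian {n : ℕ} (A : Matrix (Fin n) (Fin n) ℝ)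
    (i : Fin n) :
    IsSubexponential
      (fun x : EuclideanSpace ℝ (Fin n) => A.mulVec x.ofLp i * x i - A i i)
      (stdGaussian (EuclideanSpace ℝ (Fin n))) (∑ j, |A i j|) := by
  have h := IsSubexponential.sum_mul (isSubexponential_coord_mul_coord_stdGaussian i)
    (fun j => by fun_prop) (A i)
  convert h using 1
  ext x
  simp [Matrix.mulVec, dotProduct, mul_sub, Finset.sum_mul, Matrix.one_apply, mul_assoc]

/-! ### Matrix norms and the diagonal of the estimator. -/

theorem matrixTwoNorm_diagonal {n : ℕ} (v : Fin n → ℝ) :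
    matrixTwoNorm (Matrix.diagonal v) = ‖v‖ :=
  (Matrix.l2_opNorm_toEuclideanCLM _).trans (Matrix.l2_opNorm_diagonal v)

theorem matrixInfNorm_diagonal {n : ℕ} (v : Fin n → ℝ) :
    matrixInfNorm (Matrix.diagonal v) = ‖v‖ :=
  Matrix.linfty_opNorm_diagonal v

theorem sum_abs_le_matrixInfNorm {n : ℕ} (A : Matrix (Fin n) (Fin n) ℝ) (i : Fin n) :
    ∑ j, |A i j| ≤ matrixInfNorm A := by
  have h := Finset.le_sup (f := fun i => ∑ j, ‖A i j‖₊) (Finset.mem_univ i)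
  rw [matrixInfNorm, Matrix.linfty_opNorm_def]
  simpa [← NNReal.coe_le_coe] using h

theorem norm_diag_le_matrixInfNorm {n : ℕ} (A : Matrix (Fin n) (Fin n) ℝ) :
    ‖A.diag‖ ≤ matrixInfNorm A := by
  have h : ∀ i, ‖A.diag i‖ ≤ ∑ j, |A i j| := fun i =>
    Finset.single_le_sum (f := fun j => |A i j|) (fun j _ => abs_nonneg _) (Finset.mem_univ i)
  refine (pi_norm_le_iff_of_nonneg ?_).2 fun i => (h i).trans (sum_abs_le_matrixInfNorm A i)
  exact @norm_nonneg _ Matrix.linftyOpNormedAddCommGroup.toSeminormedAddCommGroup.toSeminormedAddGroup A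

theorem monteCarloEstimator_diag_sub {n N : ℕ} (hN : N ≠ 0) (A : Matrix (Fin n) (Fin n) ℝ)
    (w : Fin N → EuclideanSpace ℝ (Fin n)) (i : Fin n) :
    (monteCarloEstimator A w).diag i - A i i =
      (∑ k, (A.mulVec (w k).ofLp i * w k i - A i i)) / N := by
  have : (N : ℝ) ≠ 0 := Nat.cast_ne_zero.2 hN
  simp [monteCarloEstimator, Matrix.sum_apply, Matrix.vecMulVec_apply, Finset.sum_sub_distrib]
  field_simp

/-! ### From the sample size to the failure probability. -/

theorem two_mul_mul_exp_neg_le {n : ℕ} (hn : 3 ≤ n) {N η δ : ℝ} (hδ₀ : 0 < δ) (hδ₁ : δ < 1)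
    (hη : 0 ≤ η) (hN₁ : 8 * (Real.exp 1 * Real.log n) ≤ N)
    (hN₂ : 128 * (Real.exp 1 * Real.log n) ^ 3 ≤ N * η ^ 2 * δ) :
    2 * n * Real.exp (-(N * (min η (η ^ 2) / 8))) ≤ δ := by
  have hn' : (3 : ℝ) ≤ n := by exact_mod_cast hn
  have he := Real.exp_one_gt_d9
  -- Here `n ≥ 3 > e` enters.
  have hl : 1 ≤ Real.log n := by
    rw [Real.le_log_iff_exp_le (by linarith)]
    linarith [Real.exp_one_lt_d9]
  set x := Real.exp 1 * Real.log n with hx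
  have hlx : Real.log n ≤ x := le_mul_of_one_le_left (by linarith) (by linarith)
  have hx1 : 1 ≤ x := hl.trans hlx
  have hN₀ : 0 < N := by linarith
  set E := N * (min η (η ^ 2) / 8) with hE
  have hE₀ : 0 ≤ E := mul_nonneg hN₀.le (div_nonneg (le_min hη (sq_nonneg η)) (by norm_num))
  -- If the minimum is `η`, multiply the two sample-size bounds; if it is `η²`, the second gives `16
  -- x³ ≤ E δ`, hence also `x ≤ E`.
  have hE2 : 16 * x ^ 4 ≤ E ^ 2 * δ := by
    rcases min_choice η (η ^ 2) with h | h
    · rw [h] at hE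
      have := mul_le_mul hN₁ hN₂ (by positivity) hN₀.le
      rw [hE]
      nlinarith
    · rw [h] at hE
      have h1 : 16 * x ^ 3 ≤ E * δ := by rw [hE]; linarith
      have h2 : E * δ ≤ E := mul_le_of_le_one_right hE₀ hδ₁.le
      have h3 : x ≤ E := by nlinarith [pow_le_pow_right₀ hx1 (show 1 ≤ 3 by norm_num)]
      nlinarith [mul_le_mul h1 h3 (by linarith) (by positivity)]
  have hx4 : 1 ≤ x ^ 4 := one_le_pow₀ hx1
  have hEl : 4 * Real.log n ≤ E := by
    have h1 : E ^ 2 * δ ≤ E ^ 2 := mul_le_of_le_one_right (sq_nonneg E) hδ₁.le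
    have h2 : (4 * x ^ 2) ^ 2 ≤ E ^ 2 := by nlinarith
    have h3 := (pow_le_pow_iff_left₀ (by positivity) hE₀ two_ne_zero).1 h2
    nlinarith
  -- Half of the exponent absorbs `2n ≤ n²`, the other half absorbs `1 / δ`.
  have h1 : (n : ℝ) * n ≤ Real.exp (E / 2) := by
    rw [← Real.exp_log (by positivity : (0 : ℝ) < n * n), Real.log_mul (by positivity)
      (by positivity)]
    gcongr
    linarith
  have h2 : 1 ≤ Real.exp (E / 2) * δ := by
    have := Real.quadratic_le_exp_of_nonneg (by positivity : 0 ≤ E / 2)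
    nlinarith [mul_le_mul_of_nonneg_right this hδ₀.le, mul_nonneg hE₀ hδ₀.le]
  rw [Real.exp_neg, ← div_eq_mul_inv, div_le_iff₀ (Real.exp_pos E), ← add_halves E, Real.exp_add]
  nlinarith [mul_le_mul h1 h2 zero_le_one (Real.exp_pos _).le]

/-! ### Union bound over the diagonal entries. -/

theorem corollary4p2 {n N : ℕ} (hn : 3 ≤ n)
    (A : Matrix (Fin n) (Fin n) ℝ) (hA : A.IsSymm) (hD : diagPart A ≠ 0)
    {Ω : Type*} [MeasurableSpace Ω] (P : MeasureTheory.Measure Ω)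
    [MeasureTheory.IsProbabilityMeasure P]
    (w : Fin N → Ω → EuclideanSpace ℝ (Fin n))
    (hlaw : ∀ k, ProbabilityTheory.HasLaw (w k)
      (ProbabilityTheory.stdGaussian (EuclideanSpace ℝ (Fin n))) P)
    (hindep : ProbabilityTheory.iIndepFun w P)
    (ε δ : ℝ) (hε : 0 < ε) (hδ₀ : 0 < δ) (hδ₁ : δ < 1)
    (hN₁ : 8 * Real.exp 1 * Real.log n ≤ N) (hN₂ : N ≤ n)
    (hN₃ : 128 * (Real.exp 1 * Real.log n) ^ 3 / (ε ^ 2 * δ) *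
      (matrixInfNorm A / matrixInfNorm (diagPart A)) ^ 2 ≤ N) :
    1 - δ ≤ P.real {ω | matrixTwoNorm
        (diagPart A - diagPart (monteCarloEstimator A (fun k => w k ω))) ≤
      ε * matrixTwoNorm (diagPart A)} := by
  set d := ‖A.diag‖
  set L := matrixInfNorm A
  have hdpos : 0 < d := norm_pos_iff.2 fun h => hD (by rw [diagPart, h]; simp)
  have hLpos : 0 < L := hdpos.trans_le (norm_diag_le_matrixInfNorm A)
  have hDinf : matrixInfNorm (diagPart A) = d := matrixInfNorm_diagonal _
  have hD₂ : matrixTwoNorm (diagPart A) = d := matrixTwoNorm_diagonal _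
  have hlog : 0 < Real.log n := Real.log_pos (by exact_mod_cast (by omega : 1 < n))
  have hNpos : (0 : ℝ) < N := lt_of_lt_of_le (by positivity) hN₁
  have hN₀ : N ≠ 0 := by rintro rfl; simp at hNpos
  rw [hDinf] at hN₃
  rw [hD₂]
  -- Chosen so that the Bernstein threshold `η * L` equals `ε * d`.
  set η := ε * d / L with hη
  have hηL : η * L = ε * d := div_mul_cancel₀ _ hLpos.ne'
  have hη₀ : 0 < η := by positivity
  have hnum := two_mul_mul_exp_neg_le (N := N) (η := η) hn hδ₀ hδ₁ hη₀.le
    (by rwa [← mul_assoc]) (by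
      have h := mul_le_mul_of_nonneg_right hN₃ (by positivity : 0 ≤ η ^ 2 * δ)
      calc _ = _ := ?_
        _ ≤ _ := h
        _ = _ := by ring
      rw [hη]
      field_simp)
  let X : Fin n → EuclideanSpace ℝ (Fin n) → ℝ := fun i x => A.mulVec x.ofLp i * x i - A i i
  -- Passing to `-A` turns the lower tail into an upper tail.
  let Y : Fin n → EuclideanSpace ℝ (Fin n) → ℝ := fun i x => (-A).mulVec x.ofLp i * x i - (-A) i i
  have hYX : ∀ i x, Y i x = -X i x := by
    intro i x
    simp [X, Y, Matrix.neg_mulVec]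
    ring
  have tail : ∀ B : Matrix (Fin n) (Fin n) ℝ, (∀ i, ∑ j, |B i j| ≤ L) → ∀ i,
      P.real {ω | N * (η * L) ≤ ∑ k, (B.mulVec (w k ω).ofLp i * w k ω i - B i i)} ≤
        Real.exp (-(N * (min η (η ^ 2) / 8))) := by
    intro B hB i
    have hm : Measurable fun x : EuclideanSpace ℝ (Fin n) => B.mulVec x.ofLp i * x i - B i i := by
      unfold Matrix.mulVec dotProduct
      fun_prop
    exact IsSubexponential.measureReal_sum_ge_le (hindep.comp _ fun _ => hm)
      (fun k => hm.comp_aemeasurable (hlaw k).aemeasurable)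
      (fun k => ((isSubexponential_mulVec_mul_coord_stdGaussian B i).comp (hlaw k) hm).mono
        (Finset.sum_nonneg fun j _ => abs_nonneg _) (hB i)) hLpos hη₀.le
  have hX := tail A (sum_abs_le_matrixInfNorm A)
  have hY := tail (-A) (by simpa using sum_abs_le_matrixInfNorm A)
  set S := {ω | matrixTwoNorm (diagPart A - diagPart (monteCarloEstimator A fun k => w k ω)) ≤
    ε * d}
  -- Covering the whole space and using subadditivity avoids any measurability of `S`.
  have hcover : (Set.univ : Set Ω) ⊆ S ∪ ⋃ i, ({ω | N * (η * L) ≤ ∑ k, X i (w k ω)} ∪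
      {ω | N * (η * L) ≤ ∑ k, Y i (w k ω)}) := by
    intro ω _
    by_contra hω
    simp only [Set.mem_union, Set.mem_iUnion, not_or, not_exists] at hω
    refine hω.1 ?_
    change matrixTwoNorm (Matrix.diagonal _ - Matrix.diagonal _) ≤ _
    rw [Matrix.diagonal_sub, matrixTwoNorm_diagonal]
    refine (pi_norm_le_iff_of_nonneg (by positivity)).2 fun i => ?_
    have h1 := (hω.2 i).1
    have h2 := (hω.2 i).2
    simp only [Set.mem_ofPred_eq, not_le, hYX, Finset.sum_neg_distrib, hηL] at h1 h2
    have h3 := monteCarloEstimator_diag_sub hN₀ A (fun k => w k ω) i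
    rw [Matrix.diag_apply, Real.norm_eq_abs, abs_sub_comm, h3, abs_div, abs_of_pos hNpos,
      div_le_iff₀ hNpos, mul_comm]
    exact (abs_lt.2 ⟨by linarith, h1⟩).le
  have hunion : P.real (⋃ i, ({ω | N * (η * L) ≤ ∑ k, X i (w k ω)} ∪
      {ω | N * (η * L) ≤ ∑ k, Y i (w k ω)})) ≤ δ := by
    refine (measureReal_iUnion_fintype_le _).trans (le_trans ?_ hnum)
    calc _ ≤ ∑ _i : Fin n, 2 * Real.exp (-(N * (min η (η ^ 2) / 8))) :=
          Finset.sum_le_sum fun i _ =>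
            (measureReal_union_le _ _).trans (by linarith [hX i, hY i])
      _ = _ := by simp; ring
  have h := (measureReal_mono hcover).trans (measureReal_union_le (μ := P) _ _)
  rw [probReal_univ] at h
  linarith
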